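/- **Invariance of the generalized helicity.** *Setting.* Let $\Omega$ be a bounded open subset of $\mathbb R^3$ (for instance a bounded Lipschitz domain), or more generally a bounded open set with periodic boundary conditions in some coordinate directions (for instance a box with one pair of periodic faces). Let $(\cdot,\cdot)$ be the $L^2(\Omega)$ inner product, and let $H^1_0$, $H_0(\mathrm{curl})$, $H_0(\mathrm{div})$ be the closures of the smooth compactly supported functions or fields on $\Omega$ in the graph norms of $\mathrm{grad}$, $\mathrm{curl}$, $\mathrm{div}$ (on Lipschitz domains: the spaces with vanishing trace, tangential trace, and normal trace, respectively); let $L^2_0$ be the space of $L^2$ functions of mean zero. Assume that the complex $H^1_0\to H_0(\mathrm{curl})\to H_0(\mathrm{div})$ is exact at $H_0(\mathrm{curl})$: every $A\in H_0(\mathrm{curl})$ with $\mathrm{curl}\,A=0$ is $\mathrm{grad}\,\varphi$ for some $\varphi\in H^1_0$. Exactness at $H_0(\mathrm{div})$ is not assumed. Let $\tau>0$ and let $I\subset[0,\infty)$ be an interval containing $0$. A *Hodge decomposition* of $B\in L^2(\Omega)^3$ is $B=\mathrm{curl}\,A+B_H$ with $A\in H_0(\mathrm{curl})$ and $B_H\in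 H_0(\mathrm{div})$ harmonic, i.e. $\mathrm{div}\,B_H=0$ and $\mathrm{curl}\,B_H=0$. The *generalized helicity* is $\tilde{\mathcal H}(B)=(A,B+B_H)$. *(1) Continuous evolution.* Let $B\in C^1(I;L^2)$, $E\in C^0(I;L^2)$, $j(t)\in L^2$ and fields $u(t)$ satisfy, at every $t\in I$, $$\partial_tB+\mathrm{curl}\,E=0,\quad E+u\times B=0,\quad j=\mathrm{curl}\,B,\quad u=\tau\, j\times B,$$ with $B(t)\in H_0(\mathrm{div})$, $j(t),E(t)\in H_0(\mathrm{curl})$ and $\mathrm{div}\,B(0)=0$. Suppose that $B(s)$ has a Hodge decomposition at some time $s\in I$ (on bounded Lipschitz domains it always has one), and let $h$ be the resulting value $(A,B(s)+B_H)$. Then at every $t\in I$ the field $B(t)$ has a Hodge decomposition, and each of its Hodge decompositions, in any gauge, gives $\tilde{\mathcal H}(B(t))=h$. *(2) Semi-discrete scheme.* Let $V_0\to V_1\to V_2\to V_3$ (by $\mathrm{grad},\mathrm{curl},\mathrm{div}$) be a finite-dimensional subcomplex of $H^1_0\to H_0(\mathrm{curl})\to H_0(\mathrm{div})\to L^2_0$.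 Let $B_h\in C^1(I;V_2)$ with $\mathrm{div}\,B_h(0)=0$, and $E_h,j_h,H_h\in C^0(I;V_1)$, satisfy at every $t \in I$ $$(\partial_tB_h,C)+(\mathrm{curl}\,E_h,C)=0,\qquad (E_h,F)+\tau\,((j_h\times H_h)\times H_h,F)=0,$$ $$(j_h,K)=(B_h,\mathrm{curl}\,K),\qquad (H_h,G)=(B_h,G)$$ for all $C\in V_2$ and $F,K,G\in V_1$ (the triple products being integrable). A *discrete Hodge decomposition* is $B_h=\mathrm{curl}\,A_h+B_{Hh}$ with $A_h\in V_1$, $B_{Hh}\in V_2$, $\mathrm{div}\,B_{Hh}=0$ and $B_{Hh}\perp\mathrm{curl}\,V_1$. Then $B_h(t)$ has a discrete Hodge decomposition at every $t\in I$, and $\tilde{\mathcal H}_h=(A_h,B_h+B_{Hh})$ depends neither on the chosen decomposition nor on $t\in I$. *(3) Fully discrete scheme.* Let $B^0\in V_2$ with $\mathrm{div}\,B^0=0$, and let $B^1,\dots,B^N$ be obtained from $B^0$ by $N$ steps, of arbitrary positive sizes, of the $s$-stage Gauss collocation method applied to the scheme in (2). Then every $B^n$, $0\le n\le N$, has a discrete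 Hodge decomposition, and $\tilde{\mathcal H}_h(B^n)$ depends neither on the chosen decomposition nor on $n$. -/

import Mathlib

open MeasureTheory Set
open scoped ContDiff

noncomputable section

namespace MagnetoFriction

/-- Euclidean three-space. -/
abbrev E3 : Type := EuclideanSpace ℝ (Fin 3)

/-- The cross product on Euclidean three-space. -/
def cross (a b : E3) : E3 := WithLp.toLp 2 (crossProduct (WithLp.ofLp a) (WithLp.ofLp b))

/-- The partial derivative in the `i`-th coordinate direction. -/
def pd (φ : E3 → E3) (i : Fin 3) (x : E3) : E3 := fderiv ℝ φ x (EuclideanSpace.single i 1)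

/-- The classical curl of a differentiable vector field. -/
def classicalCurl (φ : E3 → E3) (x : E3) : E3 :=
  !₂[(pd φ 1 x) 2 - (pd φ 2 x) 1, (pd φ 2 x) 0 - (pd φ 0 x) 2, (pd φ 0 x) 1 - (pd φ 1 x) 0]

/-- The classical divergence of a differentiable vector field. -/
def classicalDiv (φ : E3 → E3) (x : E3) : ℝ := ∑ i, (pd φ i x) i

/-- A bounded open set `Ω`, possibly with periodic boundary conditions in some coordinate
directions. `period i = 0` means that direction `i` is not periodic; otherwise `period i` is the
period in that direction, and `carrier` is the periodic unfolding of the domain in `ℝ³`.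
With `period = 0` this is exactly a bounded open subset `carrier` of `ℝ³`. -/
structure Domain where
  carrier : Set E3
  period : Fin 3 → ℝ
  period_nonneg : ∀ i, 0 ≤ period i
  isOpen : IsOpen carrier
  periodic : ∀ i x, x + EuclideanSpace.single i (period i) ∈ carrier ↔ x ∈ carrier
  bounded : Bornology.IsBounded
    (carrier ∩ {x | ∀ i, period i ≠ 0 → x i ∈ Ico 0 (period i)})

namespace Domain

variable (D : Domain)

/-- One periodicity cell (all of `ℝ³` if no direction is periodic). -/
def cell : Set E3 := {x | ∀ i, D.period i ≠ 0 → x i ∈ Ico 0 (D.period i)}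

/-- Lebesgue measure on the domain (on one periodicity cell of it). -/
def vol : Measure E3 := volume.restrict (D.carrier ∩ D.cell)

/-- The space `L²(Ω)` of scalar functions. -/
abbrev L2S : Type := Lp ℝ 2 D.vol

/-- The space `L²(Ω)` of vector fields. -/
abbrev L2V : Type := Lp E3 2 D.vol

/-- Test functions: smooth, periodic in the periodic directions, with support contained in the
domain and compact modulo the periods. Without periods this is `C_c^∞(Ω)`. -/
structure IsTest {F : Type} [NormedAddCommGroup F] [NormedSpace ℝ F] (φ : E3 → F) : Prop where
  smooth : ContDiff ℝ ∞ φ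
  periodic : ∀ i x, φ (x + EuclideanSpace.single i (D.period i)) = φ x
  support_subset : tsupport φ ⊆ D.carrier
  compact : IsCompact (closure D.cell ∩ tsupport φ)

/-- The gradient on test functions, as a set of pairs `(f, grad f)` in `L² × L²`. -/
def testGrad : Set (D.L2S × D.L2V) :=
  {p | ∃ f : E3 → ℝ, D.IsTest f ∧ p.1 =ᵐ[D.vol] f ∧ p.2 =ᵐ[D.vol] gradient f}

/-- The curl on test fields, as a set of pairs `(φ, curl φ)` in `L² × L²`. -/
def testCurl : Set (D.L2V × D.L2V) :=
  {p | ∃ φ : E3 → E3, D.IsTest φ ∧ p.1 =ᵐ[D.vol] φ ∧ p.2 =ᵐ[D.vol] classicalCurl φ}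

/-- The divergence on test fields, as a set of pairs `(φ, div φ)` in `L² × L²`. -/
def testDiv : Set (D.L2V × D.L2S) :=
  {p | ∃ φ : E3 → E3, D.IsTest φ ∧ p.1 =ᵐ[D.vol] φ ∧ p.2 =ᵐ[D.vol] classicalDiv φ}

/-- `f ∈ H¹₀` and `g = grad f`; here `H¹₀` is the closure of the test functions in the graph norm
of `grad`. -/
def IsGrad₀ (f : D.L2S) (g : D.L2V) : Prop := (f, g) ∈ closure D.testGrad

/-- `v ∈ H₀(curl)` and `w = curl v`; here `H₀(curl)` (tangential trace zero) is the closure of the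
test fields in the graph norm of `curl`. -/
def IsCurl₀ (v w : D.L2V) : Prop := (v, w) ∈ closure D.testCurl

/-- `v ∈ H₀(div)` and `q = div v`; here `H₀(div)` (normal trace zero) is the closure of the
test fields in the graph norm of `div`. -/
def IsDiv₀ (v : D.L2V) (q : D.L2S) : Prop := (v, q) ∈ closure D.testDiv

/-- `v ∈ H(curl)` and `w = curl v`, in the sense of distributions (no boundary condition):
`(v, curl φ) = (w, φ)` for all test fields `φ`. -/
def IsWeakCurl (v w : D.L2V) : Prop := ∀ p ∈ D.testCurl, inner ℝ v p.2 = inner ℝ w p.1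

/-- Exactness of `H¹₀ → H₀(curl) → H₀(div)` at `H₀(curl)`: every curl-free field in `H₀(curl)` is
the gradient of a function in `H¹₀`. -/
def ExactAtCurl : Prop := ∀ A : D.L2V, D.IsCurl₀ A 0 → ∃ f : D.L2S, D.IsGrad₀ f A

/-- Harmonic 2-forms: fields in `H₀(div)` that are divergence-free and curl-free. -/
def IsHarmonic (v : D.L2V) : Prop := D.IsDiv₀ v 0 ∧ D.IsWeakCurl v 0

/-- `B = curl A + B_H` with `A ∈ H₀(curl)` and `B_H` harmonic. -/
def IsHodge (B A BH : D.L2V) : Prop :=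
  D.IsHarmonic BH ∧ ∃ cA, D.IsCurl₀ A cA ∧ B = cA + BH

/-- `h` is a value `(A, B + B_H)` of the generalized helicity of `B`, for some Hodge decomposition
`B = curl A + B_H` (in an arbitrary gauge). -/
def HasHelicity (B : D.L2V) (h : ℝ) : Prop :=
  ∃ A BH : D.L2V, D.IsHodge B A BH ∧ h = inner ℝ A (B + BH)

/-- Solutions on the time interval `I` of the magneto-frictional equations
`∂ₜB + curl E = 0`, `E + u × B = 0`, `j = curl B`, `u = τ j × B`,
with `B · n = 0`, `j × n = 0`, `E × n = 0` on the boundary and `div B = 0` at time `0`;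
`B` is `C¹` and `E` is continuous in time with values in `L²`. -/
structure IsSolution (τ : ℝ) (I : Set ℝ) (B E j : ℝ → D.L2V) (u : ℝ → E3 → E3) : Prop where
  advection : ∃ dB : ℝ → D.L2V, ContinuousOn dB I ∧
    ∀ t ∈ I, HasDerivWithinAt B (dB t) I t ∧ ∃ cE, D.IsCurl₀ (E t) cE ∧ dB t + cE = 0
  continuous_E : ContinuousOn E I
  ohm : ∀ t ∈ I, ∀ᵐ x ∂D.vol, E t x + cross (u t x) (B t x) = 0
  ampere : ∀ t ∈ I, D.IsWeakCurl (B t) (j t)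
  velocity : ∀ t ∈ I, ∀ᵐ x ∂D.vol, u t x = τ • cross (j t x) (B t x)
  boundary_B : ∀ t ∈ I, ∃ q, D.IsDiv₀ (B t) q
  boundary_j : ∀ t ∈ I, ∃ w, D.IsCurl₀ (j t) w
  gauss_zero : D.IsDiv₀ (B 0) 0

/-- A finite-dimensional subcomplex `V₀ → V₁ → V₂ → V₃` (by `grad`, `curl`, `div`) of
`H¹₀ → H₀(curl) → H₀(div) → L²₀`. -/
structure Subcomplex where
  V₀ : Submodule ℝ D.L2S
  V₁ : Submodule ℝ D.L2V
  V₂ : Submodule ℝ D.L2V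
  V₃ : Submodule ℝ D.L2S
  finite₀ : FiniteDimensional ℝ V₀
  finite₁ : FiniteDimensional ℝ V₁
  finite₂ : FiniteDimensional ℝ V₂
  finite₃ : FiniteDimensional ℝ V₃
  grad_mem : ∀ f ∈ V₀, ∃ g ∈ V₁, D.IsGrad₀ f g
  curl_mem : ∀ v ∈ V₁, ∃ w ∈ V₂, D.IsCurl₀ v w
  div_mem : ∀ v ∈ V₂, ∃ q ∈ V₃, D.IsDiv₀ v q
  mean_zero : ∀ q ∈ V₃, ∫ x, q x ∂D.vol = 0

namespace Subcomplex

variable {D} (S : D.Subcomplex)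

/-- `v ∈ V₁` and `w = curl v ∈ V₂`. -/
def IsCurl (v w : D.L2V) : Prop := v ∈ S.V₁ ∧ w ∈ S.V₂ ∧ D.IsCurl₀ v w

/-- Discrete harmonic 2-forms: divergence-free fields in `V₂` whose discrete curl (the `L²` adjoint
of `curl : V₁ → V₂`) vanishes. -/
def IsHarmonic (v : D.L2V) : Prop :=
  v ∈ S.V₂ ∧ D.IsDiv₀ v 0 ∧ ∀ K cK, S.IsCurl K cK → inner ℝ v cK = 0

/-- The discrete Hodge decomposition `B = curl A + B_H` with `A ∈ V₁` and `B_H` discretely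
harmonic. -/
def IsHodge (B A BH : D.L2V) : Prop :=
  S.IsHarmonic BH ∧ ∃ cA, S.IsCurl A cA ∧ B = cA + BH

/-- `h` is a value `(A, B + B_H)` of the discrete generalized helicity of `B`, for some discrete
Hodge decomposition `B = curl A + B_H`. -/
def HasHelicity (B : D.L2V) (h : ℝ) : Prop :=
  ∃ A BH : D.L2V, S.IsHodge B A BH ∧ h = inner ℝ A (B + BH)

/-- The equations of the structure-preserving scheme at one instant, for the field `B`, its time
derivative `dB` and the auxiliary fields `E`, `j`, `H`. -/
structure SchemeAt (τ : ℝ) (B dB E j H : D.L2V) : Prop where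
  mem_B : B ∈ S.V₂
  mem_j : j ∈ S.V₁
  mem_H : H ∈ S.V₁
  advection : ∃ cE, S.IsCurl E cE ∧ ∀ C ∈ S.V₂, inner ℝ dB C + inner ℝ cE C = 0
  ohm : ∀ F ∈ S.V₁,
    Integrable (fun x => inner ℝ (cross (cross (j x) (H x)) (H x)) (F x)) D.vol ∧
    inner ℝ E F + τ * ∫ x, inner ℝ (cross (cross (j x) (H x)) (H x)) (F x) ∂D.vol = 0
  current : ∀ K cK, S.IsCurl K cK → inner ℝ j K = inner ℝ B cK
  field : ∀ G ∈ S.V₁, inner ℝ H G = inner ℝ B G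

/-- Solutions of the semi-discrete scheme on the time interval `I`, with `B` of class `C¹` and
`E`, `j`, `H` continuous in time, and divergence-free initial field. -/
structure IsSolution (τ : ℝ) (I : Set ℝ) (B E j H : ℝ → D.L2V) : Prop where
  scheme : ∃ dB : ℝ → D.L2V, ContinuousOn dB I ∧
    ∀ t ∈ I, HasDerivWithinAt B (dB t) I t ∧ S.SchemeAt τ (B t) (dB t) (E t) (j t) (H t)
  continuous_E : ContinuousOn E I
  continuous_j : ContinuousOn j I
  continuous_H : ContinuousOn H I
  gauss_zero : D.IsDiv₀ (B 0) 0

/-- One step, of size `δ` and from `Bold` to `Bnew`, of the collocation method with nodes `c`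
applied to the semi-discrete scheme: there is a polynomial of degree at most `s` in time with
values in `V₂` that starts at `Bold`, satisfies the scheme at the times `c i * δ` (with stage values
`E i`, `j i`, `H i`), and ends at `Bnew`. -/
def IsCollocationStep (τ : ℝ) {s : ℕ} (c : Fin s → ℝ) (δ : ℝ) (Bold Bnew : D.L2V) : Prop :=
  ∃ (a : Fin (s + 1) → D.L2V) (p : ℝ → D.L2V) (E j H : Fin s → D.L2V),
    (∀ k, a k ∈ S.V₂) ∧ (∀ r, p r = ∑ k : Fin (s + 1), r ^ (k : ℕ) • a k) ∧ p 0 = Bold ∧ p δ = Bnew ∧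
    ∀ i, S.SchemeAt τ (p (c i * δ)) (deriv p (c i * δ)) (E i) (j i) (H i)

end Subcomplex

end Domain

/-- The nodes of the `s`-stage Gauss method: the `s` distinct zeros of the shifted Legendre
polynomial `dˢ/dxˢ (xˢ (x - 1)ˢ)`. -/
def IsGaussNodes {s : ℕ} (c : Fin s → ℝ) : Prop :=
  Function.Injective c ∧ ∀ i, (Polynomial.derivative^[s]
    ((Polynomial.X : Polynomial ℝ) ^ s * (Polynomial.X - 1) ^ s)).IsRoot (c i)

end MagnetoFriction

end

/-!
Write `∂ₜB = -curl E` and let `F` be the primitive of `E` that vanishes at time `s`. If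
`B(s) = curl A + B_H`, then `B(t) = curl (A - F(t)) + B_H` with the same `B_H`, so the Hodge
decomposition is transported by the flow; since `curl` is symmetric on `H₀(curl)`, the helicity
`(A - F, B + B_H)` has derivative `-2 (E, B)`, which vanishes because `E` is a cross product
with `B`, or because the scheme tested with `H` says so. A change of gauge alters `A` by a
curl-free field, which is orthogonal to `B + B_H`. All of this uses only a symmetric relation and
harmonic vectors orthogonal to its range and kernel, so it applies to the continuous and the
discrete curl alike.

In a Gauss step, `E` is the interpolant of the stage values and `(E, B)` is a polynomial in time
of degree at most `2s - 1` that vanishes at the `s` nodes. The helicity increment is its integral,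
which is zero because Gauss quadrature is exact in this degree.
-/

noncomputable section

namespace MagnetoFriction

section Quadrature

open Polynomial

theorem degree_iterate_derivative {R : Type*} [Semiring R] [IsAddTorsionFree R] {p : R[X]}
    {m k : ℕ} (hp : p.degree = (m + k : ℕ)) : (derivative^[k] p).degree = m := by
  induction k generalizing p with
  | zero => simpa using hp
  | succ k ih =>
    have hnat : p.natDegree = m + k + 1 := natDegree_eq_of_degree_eq_some hp
    refine ih ?_
    rw [degree_derivative (by omega), hnat, Nat.add_sub_cancel]

/-- `k` integrations by parts; the boundary terms at a zero `a` of `w` vanish as long as the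
order of the zero is at least `k`. -/
theorem exists_derivative_eq_iterate_derivative_mul {R : Type*} [CommRing R] (w : R[X]) {n k : ℕ}
    (hk : k ≤ n) {r : R[X]} (hr : r.degree < k) :
    ∃ Q : R[X], derivative Q = derivative^[k] w * r ∧
      ∀ a, (X - C a) ^ n ∣ w → Q.eval a = 0 := by
  induction k generalizing r with
  | zero =>
    have hr0 : r = 0 := degree_eq_bot.1 (Nat.WithBot.lt_zero_iff.1 (by simpa using hr))
    exact ⟨0, by simp [hr0]⟩
  | succ k ih =>
    have hr' : (derivative r).degree < k := by
      rw [degree_lt_iff_coeff_zero] at hr ⊢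
      intro m hm
      rw [coeff_derivative, hr (m + 1) (by omega), zero_mul]
    obtain ⟨Q, hQ, hQ0⟩ := ih (by omega) hr'
    refine ⟨derivative^[k] w * r - Q, ?_, fun a ha => ?_⟩
    · rw [derivative_sub, derivative_mul, hQ, Function.iterate_succ_apply', add_sub_cancel_right]
    · have hroot : (derivative^[k] w).IsRoot a := dvd_iff_isRoot.1 <|
        (dvd_pow_self _ (by omega : n - k ≠ 0)).trans
          (pow_sub_dvd_iterate_derivative_of_pow_dvd k ha)
      rw [eval_sub, eval_mul, hroot.eq_zero, hQ0 a ha, zero_mul, sub_zero]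

theorem dvd_of_degree_eq_card_of_eval_eq_zero {K ι : Type*} [Field K] {s : Finset ι} {v : ι → K}
    (hv : InjOn v s) {f g : K[X]} (hdeg : f.degree = s.card) (hf : ∀ i ∈ s, f.eval (v i) = 0)
    (hg : ∀ i ∈ s, g.eval (v i) = 0) : f ∣ g := by
  have hf0 : f ≠ 0 := by
    rintro rfl
    simp at hdeg
  refine EuclideanDomain.mod_eq_zero.1 <|
    eq_zero_of_degree_lt_of_eval_index_eq_zero s hv (hdeg ▸ degree_mod_lt g hf0) fun i hi => ?_
  have hdiv := congrArg (eval (v i)) (EuclideanDomain.div_add_mod g f)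
  simpa only [eval_add, eval_mul, hf i hi, hg i hi, zero_mul, zero_add] using hdiv

/-- The shifted Legendre polynomial of degree `s`, up to a constant factor, by Rodrigues'
formula. -/
def rodrigues (s : ℕ) : ℝ[X] := derivative^[s] (X ^ s * (X - 1) ^ s)

theorem degree_rodrigues (s : ℕ) : (rodrigues s).degree = s := by
  refine degree_iterate_derivative ?_
  rw [degree_mul, degree_pow, degree_pow, degree_X, ← C_1, degree_X_sub_C]
  simp

theorem integral_rodrigues_mul {s : ℕ} {r : ℝ[X]} (hr : r.degree < s) :
    ∫ x in (0 : ℝ)..1, (rodrigues s * r).eval x = 0 := by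
  obtain ⟨Q, hQ, hroot⟩ :=
    exists_derivative_eq_iterate_derivative_mul (X ^ s * (X - 1) ^ s : ℝ[X]) le_rfl hr
  have hQ0 : Q.eval 0 = 0 := hroot 0 (by simp)
  have hQ1 : Q.eval 1 = 0 := hroot 1 (by simp)
  rw [rodrigues, ← hQ, intervalIntegral.integral_eq_sub_of_hasDerivAt
    (fun x _ => Q.hasDerivAt x) ((derivative Q).continuous.intervalIntegrable 0 1), hQ0, hQ1,
    sub_zero]

theorem IsGaussNodes.integral_eval_eq_zero {s : ℕ} {c : Fin s → ℝ} (hc : IsGaussNodes c)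
    {q : ℝ[X]} (hdeg : q.degree < (2 * s : ℕ)) (hq : ∀ i, q.eval (c i) = 0) :
    ∫ x in (0 : ℝ)..1, q.eval x = 0 := by
  obtain ⟨r, rfl⟩ : rodrigues s ∣ q :=
    dvd_of_degree_eq_card_of_eval_eq_zero (s := Finset.univ) hc.1.injOn
      (by simp [degree_rodrigues]) (fun i _ => hc.2 i) fun i _ => hq i
  refine integral_rodrigues_mul ?_
  rcases eq_or_ne r 0 with rfl | hr0
  · simp
  rw [degree_mul, degree_rodrigues, degree_eq_natDegree hr0] at hdeg
  rw [degree_eq_natDegree hr0]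
  norm_cast at hdeg ⊢
  omega

end Quadrature

section PolynomialCurves

open Polynomial

/-- The curve `r ↦ ∑ₖ rᵏ aₖ` in a module, a polynomial of degree less than `n` with vector
coefficients. -/
def polyCurve {R V : Type*} [Semiring R] [AddCommMonoid V] [Module R V] {n : ℕ} (a : Fin n → V)
    (r : R) : V :=
  ∑ k : Fin n, r ^ (k : ℕ) • a k

theorem polyCurve_mul {R V : Type*} [CommSemiring R] [AddCommMonoid V] [Module R V] {n : ℕ}
    (a : Fin n → V) (r δ : R) :
    polyCurve a (r * δ) = polyCurve (fun k => δ ^ (k : ℕ) • a k) r := by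
  simp only [polyCurve, mul_pow, mul_smul]

theorem hasDerivAt_polyCurve {𝕜 V : Type*} [NontriviallyNormedField 𝕜] [NormedAddCommGroup V]
    [NormedSpace 𝕜 V] {n : ℕ} (a : Fin (n + 1) → V) (x : 𝕜) :
    HasDerivAt (polyCurve a) (polyCurve (fun k : Fin n => ((k : 𝕜) + 1) • a k.succ) x) x := by
  have hsum : HasDerivAt (polyCurve a)
      (∑ k : Fin (n + 1), ((k : ℕ) * x ^ ((k : ℕ) - 1)) • a k) x :=
    HasDerivAt.fun_sum fun k _ => (hasDerivAt_pow (k : ℕ) x).smul_const (a k)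
  refine hsum.congr_deriv ?_
  simp [polyCurve, Fin.sum_univ_succ, smul_smul, mul_comm]

variable {ι : Type*} [Fintype ι]

section Lagrange

variable {K : Type*} [Field K] [DecidableEq ι] {v : ι → K}

theorem sum_basis_smul_node {V : Type*} [AddCommMonoid V] [Module K V]
    (hv : Function.Injective v) (y : ι → V) (i : ι) :
    ∑ k, (Lagrange.basis Finset.univ v k).eval (v i) • y k = y i := by
  rw [Finset.sum_eq_single i (fun k _ hk => by
    rw [Lagrange.eval_basis_of_ne hk (Finset.mem_univ i), zero_smul]) (by simp),
    Lagrange.eval_basis_self hv.injOn (Finset.mem_univ i), one_smul]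

theorem sum_basis_smul_polyCurve {V : Type*} [AddCommMonoid V] [Module K V]
    (hv : Function.Injective v) {n : ℕ} (hn : n ≤ Fintype.card ι) (a : Fin n → V) (x : K) :
    ∑ i, (Lagrange.basis Finset.univ v i).eval x • polyCurve a (v i) = polyCurve a x := by
  have hmonomial : ∀ k : Fin n,
      ∑ i, (Lagrange.basis Finset.univ v i).eval x * v i ^ (k : ℕ) = x ^ (k : ℕ) := by
    intro k
    have hinterp := Lagrange.eq_interpolate (f := (X ^ (k : ℕ) : K[X])) (s := Finset.univ)
      hv.injOn (by rw [degree_X_pow, Finset.card_univ]; exact_mod_cast k.2.trans_le hn)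
    simpa [Lagrange.interpolate_apply, eval_finsetSum, mul_comm] using
      (congrArg (eval x) hinterp).symm
  simp only [polyCurve, Finset.smul_sum, smul_smul]
  rw [Finset.sum_comm]
  simp only [← Finset.sum_smul, hmonomial]

end Lagrange

theorem exists_eval_eq_inner_polyCurve {V : Type*} [NormedAddCommGroup V] [InnerProductSpace ℝ V]
    {m n : ℕ} {l : ι → ℝ[X]} (hl : ∀ i, (l i).degree < m) (e : ι → V) (a : Fin (n + 1) → V) :
    ∃ q : ℝ[X], q.degree < (m + n : ℕ) ∧
      ∀ x, q.eval x = inner ℝ (∑ i, (l i).eval x • e i) (polyCurve a x) := by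
  refine ⟨∑ k : Fin (n + 1), ∑ i, inner ℝ (e i) (a k) • (l i * X ^ (k : ℕ)), ?_, fun x => ?_⟩
  · rw [← mem_degreeLT]
    refine Submodule.sum_mem _ fun k _ => Submodule.sum_mem _ fun i _ =>
      Submodule.smul_mem _ _ ?_
    rw [mem_degreeLT, degree_lt_iff_coeff_zero]
    intro d hd
    have hlcoeff := (degree_lt_iff_coeff_zero (l i) m).1 (hl i) (d - k) (by omega)
    rw [coeff_mul_X_pow', hlcoeff, ite_self]
  · simp only [polyCurve, eval_finsetSum, eval_smul, eval_mul, eval_pow, eval_X, sum_inner,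
      inner_sum, real_inner_smul_left, real_inner_smul_right, smul_eq_mul]
    refine Finset.sum_congr rfl fun k _ => Finset.sum_congr rfl fun i _ => ?_
    ring

end PolynomialCurves

section Primitives

variable {Y : Type*} [NormedAddCommGroup Y] [NormedSpace ℝ Y]

theorem eq_of_hasDerivWithinAt_zero {J : Set ℝ} (hJ : Convex ℝ J) {f : ℝ → Y}
    (hf : ∀ r ∈ J, HasDerivWithinAt f 0 J r) {s t : ℝ} (hs : s ∈ J) (ht : t ∈ J) : f t = f s := by
  have hle := hJ.norm_image_sub_le_of_norm_hasDerivWithin_le (C := 0) hf (by simp) hs ht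
  rw [zero_mul] at hle
  exact sub_eq_zero.1 (norm_le_zero_iff.1 hle)

theorem exists_primitive_mem [CompleteSpace Y] {M : Submodule ℝ Y} (hM : IsClosed (M : Set Y))
    {s t : ℝ} {g : ℝ → Y} (hg : ContinuousOn g (uIcc s t)) (hgM : ∀ r ∈ uIcc s t, g r ∈ M) :
    ∃ F : ℝ → Y, F s = 0 ∧ (∀ r, F r ∈ M) ∧
      ∀ r ∈ uIcc s t, HasDerivWithinAt F (g r) (uIcc s t) r := by
  have : CompleteSpace M := hM.completeSpace_coe
  let gM : uIcc s t → M := fun r => ⟨g r, hgM r r.2⟩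
  have hgM_cont : Continuous gM :=
    Continuous.subtype_mk (continuousOn_iff_continuous_domRestrict.1 hg) _
  let G : ℝ → M := IccExtend min_le_max gM
  have hG : Continuous G := hgM_cont.Icc_extend'
  refine ⟨fun r => ((∫ x in s..r, G x : M) : Y), by simp, fun r => Subtype.coe_prop _,
    fun r hr => ?_⟩
  have hGr : (G r : Y) = g r := congrArg Subtype.val (IccExtend_of_mem min_le_max gM hr)
  have hderiv : HasDerivAt (fun r => ((∫ x in s..r, G x : M) : Y)) (G r) r :=
    M.subtypeL.hasFDerivAt.comp_hasDerivAt r (hG.integral_hasStrictDerivAt s r).hasDerivAt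
  exact hGr ▸ hderiv.hasDerivWithinAt

theorem exists_primitive_sum_eval_smul_mem {ι : Type*} [Fintype ι] {M : Submodule ℝ Y}
    (l : ι → Polynomial ℝ) {y : ι → Y} (hy : ∀ i, y i ∈ M) :
    ∃ F : ℝ → Y, F 0 = 0 ∧ (∀ r, F r ∈ M) ∧
      ∀ r, HasDerivAt F (∑ i, (l i).eval r • y i) r :=
  ⟨fun r => ∑ i, (∫ x in (0 : ℝ)..r, (l i).eval x) • y i, by simp,
    fun _ => M.sum_mem fun i _ => M.smul_mem _ (hy i), fun r => HasDerivAt.fun_sum fun i _ =>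
      ((l i).continuous.integral_hasStrictDerivAt 0 r).hasDerivAt.smul_const (y i)⟩

end Primitives

section IdealInduction

variable {X : Type*} [NormedAddCommGroup X] [InnerProductSpace ℝ X]

/-- Ideal induction in a Hilbert space: `∂ₜB + curl E = 0` on the time set `I` with `E`
orthogonal to `B`, where `curl` is given by its graph `C`. -/
structure IsIdealFlow (C : Submodule ℝ (X × X)) (I : Set ℝ) (B E : ℝ → X) : Prop where
  continuousOn : ContinuousOn E I
  faraday : ∃ cE : ℝ → X, ContinuousOn cE I ∧
    ∀ t ∈ I, (E t, cE t) ∈ C ∧ HasDerivWithinAt B (-cE t) I t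
  orthogonal : ∀ t ∈ I, inner ℝ (E t) (B t) = 0

/-- One step, of size `δ` and from `B₀` to `B₁`, of the collocation method with nodes `c` for ideal
induction: the equations `∂ₜB + curl E = 0` and `(E, B) = 0` hold at the times `c i * δ`. -/
def IsIdealCollocationStep (C : Submodule ℝ (X × X)) {s : ℕ} (c : Fin s → ℝ) (δ : ℝ)
    (B₀ B₁ : X) : Prop :=
  ∃ (a : Fin (s + 1) → X) (E cE : Fin s → X), polyCurve a (0 : ℝ) = B₀ ∧ polyCurve a δ = B₁ ∧
    ∀ i, (E i, cE i) ∈ C ∧ HasDerivAt (polyCurve a) (-cE i) (c i * δ) ∧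
      inner ℝ (E i) (polyCurve a (c i * δ)) = 0

/-- The data that define the generalized helicity in a Hilbert space: the graph `curl` of a
symmetric operator (a linear relation, so that no domain or single-valuedness enters) and
harmonic vectors orthogonal to its range and its kernel. -/
structure HodgeSystem (X : Type*) [NormedAddCommGroup X] [InnerProductSpace ℝ X] where
  curl : Submodule ℝ (X × X)
  harmonic : Set X
  curl_symm : ∀ p ∈ curl, ∀ q ∈ curl, inner ℝ p.1 q.2 = inner ℝ p.2 q.1
  harmonic_orth_range : ∀ v ∈ harmonic, ∀ p ∈ curl, inner ℝ v p.2 = 0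
  harmonic_orth_ker : ∀ v ∈ harmonic, ∀ p ∈ curl, p.2 = 0 → inner ℝ p.1 v = 0

namespace HodgeSystem

variable (P : HodgeSystem X)

/-- The Hodge decomposition `B = curl A + B_H`. -/
def IsHodge (B A BH : X) : Prop := BH ∈ P.harmonic ∧ ∃ cA, (A, cA) ∈ P.curl ∧ B = cA + BH

/-- `h` is a value `(A, B + B_H)` of the generalized helicity of `B`. -/
def HasHelicity (B : X) (h : ℝ) : Prop :=
  ∃ A BH : X, P.IsHodge B A BH ∧ h = inner ℝ A (B + BH)

variable {P} {B : X} {h h' : ℝ}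

theorem HasHelicity.eq (H : P.HasHelicity B h) (H' : P.HasHelicity B h') : h = h' := by
  obtain ⟨A, BH, ⟨hBH, cA, hA, hB⟩, rfl⟩ := H
  obtain ⟨A', BH', ⟨hBH', cA', hA', hB'⟩, rfl⟩ := H'
  have hgauge : (A - A', cA - cA') ∈ P.curl := P.curl.sub_mem hA hA'
  have hdiff : cA - cA' = BH' - BH := by
    rw [sub_eq_sub_iff_add_eq_add, ← hB, add_comm, ← hB']
  have hcurl_eq : cA - cA' = 0 := by
    rw [← inner_self_eq_zero (𝕜 := ℝ)]
    nth_rw 1 [hdiff]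
    rw [inner_sub_left, P.harmonic_orth_range _ hBH' _ hgauge,
      P.harmonic_orth_range _ hBH _ hgauge, sub_zero]
  obtain rfl : BH' = BH := by rwa [hcurl_eq, eq_comm, sub_eq_zero] at hdiff
  have horth_harmonic : inner ℝ (A - A') BH' = 0 := P.harmonic_orth_ker _ hBH _ hgauge hcurl_eq
  have horth_range : inner ℝ (A - A') cA = 0 := by
    rw [P.curl_symm _ hgauge _ hA, hcurl_eq, inner_zero_left]
  rw [← sub_eq_zero, ← inner_sub_left, hB]
  simp only [inner_add_right, horth_range, horth_harmonic, add_zero]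

theorem HasHelicity.iff_eq (H : P.HasHelicity B h) : P.HasHelicity B h' ↔ h' = h :=
  ⟨fun H' => H'.eq H, fun e => e ▸ H⟩

section Transport

variable {J : Set ℝ} {B : ℝ → X} {BH : X}

theorem IsHodge.sub_primitive {A : X} {s t : ℝ} {G F : ℝ → X × X} (hA : P.IsHodge (B s) A BH)
    (hJ : Convex ℝ J) (hs : s ∈ J) (ht : t ∈ J) (hF0 : F s = 0) (hFt : F t ∈ P.curl)
    (hF : ∀ r ∈ J, HasDerivWithinAt F (G r) J r)
    (hB : ∀ r ∈ J, HasDerivWithinAt B (-(G r).2) J r) : P.IsHodge (B t) (A - (F t).1) BH := by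
  obtain ⟨hBH, cA, hA, hBs⟩ := hA
  refine ⟨hBH, cA - (F t).2, P.curl.sub_mem hA hFt, ?_⟩
  have hconst : B t + (F t).2 = B s + (F s).2 :=
    eq_of_hasDerivWithinAt_zero hJ (f := fun r => B r + (F r).2) (fun r hr =>
      ((hB r hr).add ((ContinuousLinearMap.snd ℝ X X).hasFDerivAt.comp_hasDerivWithinAt r
        (hF r hr))).congr_deriv (neg_add_cancel _)) hs ht
  rw [hF0, Prod.snd_zero, add_zero, hBs] at hconst
  rw [eq_sub_of_add_eq hconst]
  abel

theorem IsHodge.hasDerivWithinAt_helicity {A : X} {t : ℝ} {F : ℝ → X × X} {g : X × X}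
    (hg : g ∈ P.curl) (h : P.IsHodge (B t) (A - (F t).1) BH) (hF : HasDerivWithinAt F g J t)
    (hB : HasDerivWithinAt B (-g.2) J t) :
    HasDerivWithinAt (fun r => inner ℝ (A - (F r).1) (B r + BH)) (-2 * inner ℝ g.1 (B t)) J t := by
  obtain ⟨-, cA, hcA, hBt⟩ := h
  have hA : HasDerivWithinAt (fun r => A - (F r).1) (-g.1) J t :=
    ((ContinuousLinearMap.fst ℝ X X).hasFDerivAt.comp_hasDerivWithinAt t hF).const_sub A
  have hsymm : inner ℝ (A - (F t).1) g.2 = inner ℝ g.1 (B t) - inner ℝ g.1 BH := by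
    rw [P.curl_symm _ hcA _ hg, real_inner_comm, ← inner_sub_right, hBt, add_sub_cancel_right]
  refine (hA.inner ℝ (hB.add_const BH)).congr_deriv ?_
  rw [inner_neg_right, inner_neg_left, inner_add_right, hsymm]
  ring

end Transport

theorem HasHelicity.of_isIdealFlow [CompleteSpace X] (hcl : IsClosed (P.curl : Set (X × X)))
    {I : Set ℝ} (hI : I.OrdConnected) {B E : ℝ → X} (hflow : IsIdealFlow P.curl I B E) {s t : ℝ}
    (hs : s ∈ I) (ht : t ∈ I) (H : P.HasHelicity (B s) h) : P.HasHelicity (B t) h := by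
  obtain ⟨A, BH, hA, rfl⟩ := H
  obtain ⟨cE, hcE, hE⟩ := hflow.faraday
  have hsub : uIcc s t ⊆ I := hI.uIcc_subset hs ht
  have hB : ∀ r ∈ uIcc s t, HasDerivWithinAt B (-cE r) (uIcc s t) r :=
    fun r hr => (hE r (hsub hr)).2.mono hsub
  obtain ⟨F, hF0, hFcurl, hF⟩ := exists_primitive_mem hcl
    ((hflow.continuousOn.prodMk hcE).mono hsub) fun r hr => (hE r (hsub hr)).1
  have hHodge : ∀ r ∈ uIcc s t, P.IsHodge (B r) (A - (F r).1) BH := fun r hr =>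
    hA.sub_primitive (convex_uIcc s t) left_mem_uIcc hr hF0 (hFcurl r) hF hB
  refine ⟨A - (F t).1, BH, hHodge t right_mem_uIcc, ?_⟩
  have hconst := eq_of_hasDerivWithinAt_zero (convex_uIcc s t)
    (f := fun r => inner ℝ (A - (F r).1) (B r + BH))
    (fun r hr => ((hHodge r hr).hasDerivWithinAt_helicity (hE r (hsub hr)).1
      (hF r hr) (hB r hr)).congr_deriv
        (by rw [hflow.orthogonal r (hsub hr), mul_zero])) left_mem_uIcc right_mem_uIcc
  simpa only [hF0, Prod.fst_zero, sub_zero] using hconst.symm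

section Gauss

variable {s : ℕ} {c : Fin s → ℝ}

theorem hasDerivAt_polyCurve_of_nodes (hc : Function.Injective c) {a : Fin (s + 1) → X}
    {g : Fin s → X} (ha : ∀ i, HasDerivAt (polyCurve a) (g i) (c i)) (r : ℝ) :
    HasDerivAt (polyCurve a) (∑ i, (Lagrange.basis Finset.univ c i).eval r • g i) r := by
  refine (hasDerivAt_polyCurve a r).congr_deriv ?_
  rw [← sum_basis_smul_polyCurve hc (by simp)]
  simp only [(ha _).unique (hasDerivAt_polyCurve a _)]

theorem HasHelicity.of_gauss (hc : IsGaussNodes c) {a : Fin (s + 1) → X} {g : Fin s → X × X}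
    (hg : ∀ i, g i ∈ P.curl) (ha : ∀ i, HasDerivAt (polyCurve a) (-(g i).2) (c i))
    (horth : ∀ i, inner ℝ (g i).1 (polyCurve a (c i)) = 0)
    (H : P.HasHelicity (polyCurve a (0 : ℝ)) h) : P.HasHelicity (polyCurve a (1 : ℝ)) h := by
  obtain ⟨A, BH, hA, rfl⟩ := H
  let l : Fin s → Polynomial ℝ := Lagrange.basis Finset.univ c
  let G : ℝ → X × X := fun r => ∑ i, (l i).eval r • g i
  have hG1 : ∀ r, (G r).1 = ∑ i, (l i).eval r • (g i).1 := fun r => by simp [G, Prod.fst_sum]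
  have hB : ∀ r, HasDerivAt (polyCurve a) (-(G r).2) r := fun r => by
    simpa [G, l, Prod.snd_sum] using hasDerivAt_polyCurve_of_nodes hc.1 ha r
  obtain ⟨F, hF0, hFcurl, hF⟩ := exists_primitive_sum_eval_smul_mem l hg
  have hHodge : ∀ r : ℝ, P.IsHodge (polyCurve a r) (A - (F r).1) BH := fun r =>
    hA.sub_primitive convex_univ (mem_univ _) (mem_univ r) hF0 (hFcurl r)
      (fun r _ => (hF r).hasDerivWithinAt) fun r _ => (hB r).hasDerivWithinAt
  refine ⟨A - (F 1).1, BH, hHodge 1, ?_⟩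
  have hl : ∀ i, (l i).degree < s := fun i => by
    rw [Lagrange.degree_basis hc.1.injOn (Finset.mem_univ i), Finset.card_fin]
    exact_mod_cast Nat.sub_lt i.pos one_pos
  obtain ⟨q, hqdeg, hq⟩ := exists_eval_eq_inner_polyCurve hl (fun i => (g i).1) a
  have hderiv : ∀ r, HasDerivAt (fun r => inner ℝ (A - (F r).1) (polyCurve a r + BH))
      (-2 * q.eval r) r := fun r => by
    rw [hq, ← hG1, ← hasDerivWithinAt_univ]
    exact (hHodge r).hasDerivWithinAt_helicity
      (P.curl.sum_mem fun i _ => P.curl.smul_mem _ (hg i))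
      (hF r).hasDerivWithinAt (hB r).hasDerivWithinAt
  have hq0 : ∫ r in (0 : ℝ)..1, q.eval r = 0 := hc.integral_eval_eq_zero
    (two_mul s ▸ hqdeg) fun i => by rw [hq, sum_basis_smul_node hc.1, horth]
  have hFTC := intervalIntegral.integral_eq_sub_of_hasDerivAt (fun r _ => hderiv r)
    ((q.continuous.const_mul (-2)).intervalIntegrable 0 1)
  rw [intervalIntegral.integral_const_mul, hq0, mul_zero, eq_comm, sub_eq_zero] at hFTC
  simpa only [hF0, Prod.fst_zero, sub_zero] using hFTC.symm

theorem HasHelicity.of_isIdealCollocationStep (hc : IsGaussNodes c) {δ : ℝ} {B₀ B₁ : X}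
    (hstep : IsIdealCollocationStep P.curl c δ B₀ B₁) (H : P.HasHelicity B₀ h) :
    P.HasHelicity B₁ h := by
  obtain ⟨a, E, cE, rfl, rfl, hE⟩ := hstep
  have hrescale : polyCurve (fun k => δ ^ (k : ℕ) • a k) = fun r : ℝ => polyCurve a (r * δ) :=
    funext fun r => (polyCurve_mul a r δ).symm
  have hunit := HasHelicity.of_gauss (P := P) (h := h) hc
    (a := fun k => δ ^ (k : ℕ) • a k) (g := fun i => δ • (E i, cE i))
    (fun i => P.curl.smul_mem δ (hE i).1) (fun i => ?_) (fun i => ?_)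
  · simpa only [hrescale, zero_mul, one_mul] using hunit (by simpa only [hrescale, zero_mul])
  · rw [hrescale, Prod.smul_snd, ← smul_neg]
    exact (hE i).2.1.scomp (c i) (hasDerivAt_mul_const δ)
  · rw [hrescale, Prod.smul_fst, real_inner_smul_left, (hE i).2.2, mul_zero]

end Gauss

end HodgeSystem

end IdealInduction

section VectorCalculus

/-- The cross product as a continuous bilinear map. -/
def crossL : E3 →L[ℝ] E3 →L[ℝ] E3 :=
  (LinearMap.mk₂ ℝ cross
    (fun a b c => by ext i; simp [cross]) (fun r a b => by ext i; simp [cross])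
    (fun a b c => by ext i; simp [cross])
    (fun r a b => by ext i; simp [cross])).toContinuousBilinearMap

@[simp]
theorem crossL_apply (a b : E3) : crossL a b = cross a b := rfl

/-- The curl as a linear function of the Jacobian. -/
def curlL : (E3 →L[ℝ] E3) →L[ℝ] E3 :=
  LinearMap.toContinuousLinearMap
    { toFun := fun J => !₂[(J (EuclideanSpace.single 1 1)) 2 - (J (EuclideanSpace.single 2 1)) 1,
        (J (EuclideanSpace.single 2 1)) 0 - (J (EuclideanSpace.single 0 1)) 2,
        (J (EuclideanSpace.single 0 1)) 1 - (J (EuclideanSpace.single 1 1)) 0]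
      map_add' := fun J K => by ext i; fin_cases i <;> simp <;> ring
      map_smul' := fun r J => by ext i; fin_cases i <;> simp <;> ring }

/-- The divergence as a linear function of the Jacobian, that is, the trace. -/
def divL : (E3 →L[ℝ] E3) →L[ℝ] ℝ :=
  LinearMap.toContinuousLinearMap
    { toFun := fun J => ∑ i, (J (EuclideanSpace.single i 1)) i
      map_add' := fun J K => by simp [Finset.sum_add_distrib]
      map_smul' := fun r J => by simp [Finset.mul_sum] }

theorem divL_apply (J : E3 →L[ℝ] E3) : divL J = ∑ i, (J (EuclideanSpace.single i 1)) i := rfl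

theorem classicalDiv_eq (φ : E3 → E3) : classicalDiv φ = fun x => divL (fderiv ℝ φ x) := rfl

variable {f : E3 → ℝ} {φ ψ : E3 → E3} {x : E3}

theorem classicalDiv_classicalCurl (hφ : ContDiffAt ℝ 2 φ x) :
    classicalDiv (classicalCurl φ) x = 0 := by
  have hd : HasFDerivAt (fderiv ℝ φ) (fderiv ℝ (fderiv ℝ φ) x) x :=
    ((hφ.fderiv_right (m := 1) le_rfl).differentiableAt one_ne_zero).hasFDerivAt
  have hcurl : fderiv ℝ (classicalCurl φ) x = curlL.comp (fderiv ℝ (fderiv ℝ φ) x) :=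
    (curlL.hasFDerivAt.comp x hd).fderiv
  have hsymm : ∀ v w, fderiv ℝ (fderiv ℝ φ) x v w = fderiv ℝ (fderiv ℝ φ) x w v :=
    hφ.isSymmSndFDerivAt (by simp)
  simp only [classicalDiv_eq, hcurl, divL_apply, curlL, LinearMap.coe_toContinuousLinearMap',
    LinearMap.coe_mk, AddHom.coe_mk, ContinuousLinearMap.comp_apply, Fin.sum_univ_three,
    Matrix.cons_val_zero, Matrix.cons_val_one, Matrix.cons_val]
  rw [hsymm (EuclideanSpace.single 1 1) (EuclideanSpace.single 0 1),
    hsymm (EuclideanSpace.single 2 1) (EuclideanSpace.single 0 1),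
    hsymm (EuclideanSpace.single 2 1) (EuclideanSpace.single 1 1)]
  ring

theorem classicalDiv_cross (hφ : DifferentiableAt ℝ φ x) (hψ : DifferentiableAt ℝ ψ x) :
    classicalDiv (fun y => crossL (φ y) (ψ y)) x =
      inner ℝ (classicalCurl φ x) (ψ x) - inner ℝ (φ x) (classicalCurl ψ x) := by
  have hproduct := (crossL.hasFDerivAt_of_bilinear hφ.hasFDerivAt hψ.hasFDerivAt).fderiv
  simp only [classicalDiv_eq, hproduct, divL_apply, classicalCurl, pd, Fin.sum_univ_three,
    PiLp.inner_apply]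
  simp [cross, cross_apply]
  ring

theorem classicalDiv_smul (hf : DifferentiableAt ℝ f x) (hφ : DifferentiableAt ℝ φ x) :
    classicalDiv (fun y => f y • φ y) x =
      inner ℝ (gradient f x) (φ x) + inner ℝ (f x) (classicalDiv φ x) := by
  have hproduct := (hf.hasFDerivAt.fun_smul hφ.hasFDerivAt).fderiv
  have hbasis : φ x = ∑ i, φ x i • EuclideanSpace.single i (1 : ℝ) := by
    ext j
    fin_cases j <;> simp [Fin.sum_univ_three]
  have hgrad : inner ℝ (gradient f x) (φ x) = ∑ i, φ x i * fderiv ℝ f x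
      (EuclideanSpace.single i 1) := by
    rw [← InnerProductSpace.toDual_apply_apply, toDual_gradient]
    conv_lhs => rw [hbasis]
    simp only [map_sum, map_smul, smul_eq_mul]
  simp only [hgrad, classicalDiv_eq, hproduct]
  simp [divL_apply, Fin.sum_univ_three]
  ring

theorem inner_cross_self_right (a b : E3) : inner ℝ (cross a b) b = 0 := by
  simp only [PiLp.inner_apply, Fin.sum_univ_three]
  simp [cross, cross_apply]
  ring

theorem integral_classicalDiv_Icc (hφ : ContDiff ℝ 1 φ) {a b : Fin 3 → ℝ} (hab : a ≤ b)
    (hfaces : ∀ i, ∀ y ∈ Icc (a ∘ i.succAbove) (b ∘ i.succAbove),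
      φ (WithLp.toLp 2 (i.insertNth (b i) y)) i = φ (WithLp.toLp 2 (i.insertNth (a i) y)) i) :
    ∫ y in Icc a b, classicalDiv φ (WithLp.toLp 2 y) = 0 := by
  let e : E3 ≃L[ℝ] (Fin 3 → ℝ) := EuclideanSpace.equiv (Fin 3) ℝ
  have hderiv : ∀ y, HasFDerivAt (fun y => e (φ (e.symm y)))
      ((e : E3 →L[ℝ] (Fin 3 → ℝ)) ∘L fderiv ℝ φ (e.symm y) ∘L e.symm) y := fun y =>
    e.hasFDerivAt.comp y
      ((hφ.differentiable one_ne_zero (e.symm y)).hasFDerivAt.comp y e.symm.hasFDerivAt)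
  have hcont : Continuous fun y => classicalDiv φ (e.symm y) :=
    divL.continuous.comp ((hφ.continuous_fderiv one_ne_zero).comp e.symm.continuous)
  have hfaces_integral := integral_divergence_of_hasFDerivAt_off_countable a b hab
    (fun y => e (φ (e.symm y))) _ ∅ countable_empty
    (e.continuous.comp (hφ.continuous.comp e.symm.continuous)).continuousOn
    (fun y _ => hderiv y) (hcont.continuousOn.integrableOn_compact isCompact_Icc)
  refine hfaces_integral.trans (Finset.sum_eq_zero fun i _ => sub_eq_zero.2 ?_)
  exact setIntegral_congr_fun measurableSet_Icc fun y hy => hfaces i y hy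

end VectorCalculus

namespace Domain

variable {D : Domain}

section IsTest

variable {F G K : Type} [NormedAddCommGroup F] [NormedSpace ℝ F] [NormedAddCommGroup G]
  [NormedSpace ℝ G] [NormedAddCommGroup K] [NormedSpace ℝ K] {φ : E3 → F}

theorem IsTest.differentiable (hφ : D.IsTest φ) : Differentiable ℝ φ :=
  hφ.smooth.differentiable (by simp)

theorem IsTest.of_tsupport_subset (hφ : D.IsTest φ) {ψ : E3 → G} (hψ : ContDiff ℝ ∞ ψ)
    (hperiodic : ∀ i x, ψ (x + EuclideanSpace.single i (D.period i)) = ψ x)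
    (hsub : tsupport ψ ⊆ tsupport φ) : D.IsTest ψ where
  smooth := hψ
  periodic := hperiodic
  support_subset := hsub.trans hφ.support_subset
  compact := hφ.compact.of_isClosed_subset (isClosed_closure.inter (isClosed_tsupport _))
    (inter_subset_inter_right _ hsub)

theorem IsTest.zero : D.IsTest (fun _ => (0 : F)) where
  smooth := contDiff_const
  periodic _ _ := rfl
  support_subset := by simp [tsupport, Function.support_fun_zero]
  compact := by simp [tsupport, Function.support_fun_zero]

theorem IsTest.add {ψ : E3 → F} (hφ : D.IsTest φ) (hψ : D.IsTest ψ) :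
    D.IsTest (fun x => φ x + ψ x) where
  smooth := hφ.smooth.add hψ.smooth
  periodic i x := by rw [hφ.periodic, hψ.periodic]
  support_subset := (tsupport_add φ ψ).trans
    (union_subset hφ.support_subset hψ.support_subset)
  compact := by
    refine (hφ.compact.union hψ.compact).of_isClosed_subset
      (isClosed_closure.inter (isClosed_tsupport _)) ?_
    rw [← inter_union_distrib_left]
    exact inter_subset_inter_right _ (tsupport_add φ ψ)

theorem IsTest.bilin (hφ : D.IsTest φ) {ψ : E3 → G} (hψ : D.IsTest ψ) (L : F →L[ℝ] G →L[ℝ] K) :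
    D.IsTest (fun x => L (φ x) (ψ x)) :=
  hφ.of_tsupport_subset ((L.contDiff.comp hφ.smooth).clm_apply hψ.smooth)
    (fun i x => by rw [hφ.periodic, hψ.periodic])
    (closure_mono fun x hx hφx => hx (by simp [hφx]))

theorem IsTest.clm (hφ : D.IsTest φ) (L : F →L[ℝ] G) : D.IsTest (fun x => L (φ x)) :=
  hφ.of_tsupport_subset (L.contDiff.comp hφ.smooth) (fun i x => by rw [hφ.periodic])
    (closure_mono fun x hx hφx => hx (by simp [hφx]))

theorem IsTest.fderiv (hφ : D.IsTest φ) : D.IsTest (fderiv ℝ φ) :=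
  hφ.of_tsupport_subset (hφ.smooth.fderiv_right le_rfl)
    (fun i x => by
      rw [← fderiv_comp_add_right]
      exact congrArg (_root_.fderiv ℝ · x) (funext fun y => hφ.periodic i y))
    (tsupport_fderiv_subset ℝ)

theorem IsTest.classicalCurl {φ : E3 → E3} (hφ : D.IsTest φ) : D.IsTest (classicalCurl φ) :=
  hφ.fderiv.clm curlL

end IsTest

section DivergenceTheorem

theorem cell_eq_preimage :
    D.cell = EuclideanSpace.equiv (Fin 3) ℝ ⁻¹'
      pi {i | D.period i ≠ 0} fun i => Ico 0 (D.period i) := rfl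

theorem closure_cell : closure D.cell = {x | ∀ i, D.period i ≠ 0 → x i ∈ Icc 0 (D.period i)} := by
  rw [cell_eq_preimage, ← ContinuousLinearEquiv.coe_toHomeomorph, ← Homeomorph.preimage_closure,
    closure_pi_set]
  ext x
  refine forall₂_congr fun i (hi : D.period i ≠ 0) => ?_
  change x i ∈ closure (Ico 0 (D.period i)) ↔ _
  rw [closure_Ico hi.symm]

theorem measurableSet_cell : MeasurableSet D.cell := by
  rw [cell_eq_preimage]
  exact (MeasurableSet.pi (to_countable _) fun _ _ => measurableSet_Ico).preimage
    (ContinuousLinearEquiv.continuous _).measurable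

/-- The lower corner of a box that contains the part in one cell of the ball of radius `R`. -/
def boxLower (D : Domain) (R : ℝ) (i : Fin 3) : ℝ := if D.period i = 0 then -R else 0

/-- The upper corner of the box of `boxLower`. -/
def boxUpper (D : Domain) (R : ℝ) (i : Fin 3) : ℝ := if D.period i = 0 then R else D.period i

theorem boxLower_le_boxUpper {R : ℝ} (hR : 0 ≤ R) : D.boxLower R ≤ D.boxUpper R := fun i => by
  unfold boxLower boxUpper
  split_ifs
  · linarith
  · exact D.period_nonneg i

theorem toLp_mem_closure_cell {R : ℝ} {y : Fin 3 → ℝ}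
    (hy : y ∈ Icc (D.boxLower R) (D.boxUpper R)) : WithLp.toLp 2 y ∈ closure D.cell := by
  rw [closure_cell]
  intro i hi
  simpa [boxLower, boxUpper, hi] using And.intro (hy.1 i) (hy.2 i)

theorem mem_cell_iff_of_norm_lt {R : ℝ} {x : E3} (hx : ‖x‖ < R) :
    x ∈ D.cell ↔ ∀ i, x i ∈ Ico (D.boxLower R i) (D.boxUpper R i) := by
  refine forall_congr' fun i => ?_
  have hxi : |x i| < R := (PiLp.norm_apply_le x i).trans_lt hx
  by_cases hi : D.period i = 0
  · simp [boxLower, boxUpper, hi, (abs_lt.1 hxi).1.le, (abs_lt.1 hxi).2]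
  · simp [boxLower, boxUpper, hi]

theorem setIntegral_Icc_toLp {E : Type*} [NormedAddCommGroup E] [NormedSpace ℝ E]
    (g : E3 → E) (a b : Fin 3 → ℝ) : ∫ y in Icc a b, g (WithLp.toLp 2 y) =
      ∫ x in {x : E3 | ∀ i, x i ∈ Ico (a i) (b i)}, g x := by
  have hpreimage : {x : E3 | ∀ i, x i ∈ Ico (a i) (b i)} =
      WithLp.ofLp ⁻¹' pi univ fun i => Ico (a i) (b i) := by
    ext x
    simp only [mem_ofPred_eq, mem_preimage, mem_univ_pi]
  rw [hpreimage, volume_pi,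
    ← setIntegral_congr_set (Measure.univ_pi_Ico_ae_eq_Icc (μ := fun _ => volume)), ← volume_pi,
    ← (PiLp.volume_preserving_ofLp (Fin 3)).setIntegral_preimage_emb
      (MeasurableEquiv.toLp 2 (Fin 3 → ℝ)).symm.measurableEmbedding]

theorem integral_vol_eq_box {E : Type*} [NormedAddCommGroup E] [NormedSpace ℝ E] {g : E3 → E}
    {T : Set E3} (hT : T ⊆ D.carrier) (hg : ∀ x ∉ T, g x = 0) {R : ℝ}
    (hR : ∀ x ∈ closure D.cell ∩ T, ‖x‖ < R) :
    ∫ x, g x ∂D.vol = ∫ y in Icc (D.boxLower R) (D.boxUpper R), g (WithLp.toLp 2 y) := by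
  have hmeas : MeasurableSet {x : E3 | ∀ i, x i ∈ Ico (D.boxLower R i) (D.boxUpper R i)} := by
    measurability
  rw [setIntegral_Icc_toLp, vol, ← integral_indicator hmeas,
    ← integral_indicator (D.isOpen.measurableSet.inter measurableSet_cell)]
  congr 1 with x
  by_cases hx : x ∈ T
  · have hiff : x ∈ D.carrier ∩ D.cell ↔ ∀ i, x i ∈ Ico (D.boxLower R i) (D.boxUpper R i) := by
      refine ⟨fun h => (mem_cell_iff_of_norm_lt (hR x ⟨subset_closure h.2, hx⟩)).1 h.2,
        fun h => ⟨hT hx, (mem_cell_iff_of_norm_lt (hR x ⟨?_, hx⟩)).2 h⟩⟩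
      exact toLp_mem_closure_cell (y := WithLp.ofLp x) ⟨fun i => (h i).1, fun i => (h i).2.le⟩
    exact indicator_eq_indicator hiff rfl
  · simp only [indicator, hg x hx, ite_self]

variable {φ : E3 → E3}

theorem IsTest.eq_on_opposite_faces (hφ : D.IsTest φ) {R : ℝ} (hR0 : 0 ≤ R)
    (hR : ∀ x ∈ closure D.cell ∩ tsupport φ, ‖x‖ < R) (i : Fin 3) {y : Fin 2 → ℝ}
    (hy : y ∈ Icc (D.boxLower R ∘ i.succAbove) (D.boxUpper R ∘ i.succAbove)) :
    φ (WithLp.toLp 2 (i.insertNth (D.boxUpper R i) y)) =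
      φ (WithLp.toLp 2 (i.insertNth (D.boxLower R i) y)) := by
  by_cases hi : D.period i = 0
  · have hzero : ∀ r ∈ Icc (D.boxLower R i) (D.boxUpper R i), R ≤ |r| →
        φ (WithLp.toLp 2 (i.insertNth r y)) = 0 := by
      intro r hr hrR
      refine image_eq_zero_of_notMem_tsupport fun hsupp => ?_
      have hnorm := hR _ ⟨toLp_mem_closure_cell (Fin.insertNth_mem_Icc.2 ⟨hr, hy⟩), hsupp⟩
      refine hnorm.not_ge (hrR.trans ?_)
      simpa using PiLp.norm_apply_le (WithLp.toLp 2 (i.insertNth r y : Fin 3 → ℝ)) i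
    have hle := boxLower_le_boxUpper (D := D) hR0 i
    rw [hzero _ (right_mem_Icc.2 hle) (by simp [boxUpper, hi, abs_of_nonneg hR0]),
      hzero _ (left_mem_Icc.2 hle) (by simp [boxLower, hi, abs_of_nonneg hR0])]
  · rw [← hφ.periodic i (WithLp.toLp 2 (i.insertNth (D.boxLower R i) y))]
    congr 1
    ext k
    refine Fin.succAboveCases i ?_ (fun m => ?_) k
    · simp [boxLower, boxUpper, hi]
    · simp

theorem IsTest.integral_classicalDiv (hφ : D.IsTest φ) : ∫ x, classicalDiv φ x ∂D.vol = 0 := by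
  obtain ⟨R, hR0, hR⟩ := hφ.compact.isBounded.exists_pos_norm_lt
  have hsupp : ∀ x ∉ tsupport φ, classicalDiv φ x = 0 := fun x hx => by
    simp only [classicalDiv_eq, fderiv_of_notMem_tsupport ℝ hx, map_zero]
  rw [integral_vol_eq_box hφ.support_subset hsupp hR]
  exact integral_classicalDiv_Icc (hφ.smooth.of_le (by simp)) (boxLower_le_boxUpper hR0.le)
    fun i y hy => congrArg (· i) (hφ.eq_on_opposite_faces hR0.le hR i hy)

end DivergenceTheorem

section Graphs

variable {F G : Type} [NormedAddCommGroup F] [NormedSpace ℝ F] [NormedAddCommGroup G]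
  [NormedSpace ℝ G]

/-- The first-order operator `φ ↦ L (Dφ)` on test functions, as a linear relation in `L² × L²`. -/
def testGraph (D : Domain) (L : (E3 →L[ℝ] F) →L[ℝ] G) :
    Submodule ℝ (Lp F 2 D.vol × Lp G 2 D.vol) where
  carrier := {p | ∃ φ : E3 → F, D.IsTest φ ∧ p.1 =ᵐ[D.vol] φ ∧
    p.2 =ᵐ[D.vol] fun x => L (fderiv ℝ φ x)}
  zero_mem' := by
    refine ⟨fun _ => 0, IsTest.zero, Lp.coeFn_zero _ _ _, ?_⟩
    filter_upwards [Lp.coeFn_zero G 2 D.vol] with x hx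
    rw [Prod.snd_zero, hx]
    simp
  add_mem' := by
    rintro p q ⟨φ, hφ, hp₁, hp₂⟩ ⟨ψ, hψ, hq₁, hq₂⟩
    refine ⟨_, hφ.add hψ, (Lp.coeFn_add p.1 q.1).trans (hp₁.add hq₁), ?_⟩
    filter_upwards [hp₂, hq₂, Lp.coeFn_add p.2 q.2] with x hp hq hpq
    rw [Prod.snd_add, hpq, Pi.add_apply, hp, hq,
      fderiv_fun_add (hφ.differentiable x) (hψ.differentiable x), map_add]
  smul_mem' := by
    rintro r p ⟨φ, hφ, hp₁, hp₂⟩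
    refine ⟨_, hφ.clm (r • ContinuousLinearMap.id ℝ F),
      (Lp.coeFn_smul r p.1).trans (hp₁.const_smul r), ?_⟩
    filter_upwards [hp₂, Lp.coeFn_smul r p.2] with x hp hrp
    rw [Prod.smul_snd, hrp, Pi.smul_apply, hp]
    simp only [smul_apply, ContinuousLinearMap.id_apply]
    rw [fderiv_fun_const_smul (hφ.differentiable x), map_smul]

/-- The graph of `curl` on `H₀(curl)`; its membership relation is `IsCurl₀`. -/
def curlGraph (D : Domain) : Submodule ℝ (D.L2V × D.L2V) := (D.testGraph curlL).topologicalClosure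

theorem isClosed_curlGraph : IsClosed (D.curlGraph : Set (D.L2V × D.L2V)) :=
  Submodule.isClosed_topologicalClosure _

theorem IsDiv₀.sub {v v' : D.L2V} {q q' : D.L2S} (hv : D.IsDiv₀ v q) (hv' : D.IsDiv₀ v' q') :
    D.IsDiv₀ (v - v') (q - q') :=
  (D.testGraph divL).topologicalClosure.sub_mem hv hv'

end Graphs

section Green

theorem testCurl_symm {p q : D.L2V × D.L2V} (hp : p ∈ D.testCurl) (hq : q ∈ D.testCurl) :
    inner ℝ p.1 q.2 = inner ℝ p.2 q.1 := by
  obtain ⟨φ, hφ, hp₁, hp₂⟩ := hp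
  obtain ⟨ψ, hψ, hq₁, hq₂⟩ := hq
  rw [eq_comm, ← sub_eq_zero, L2.inner_def, L2.inner_def,
    ← integral_sub (L2.integrable_inner _ _) (L2.integrable_inner _ _),
    ← (hφ.bilin hψ crossL).integral_classicalDiv]
  refine integral_congr_ae ?_
  filter_upwards [hp₁, hp₂, hq₁, hq₂] with x hp₁ hp₂ hq₁ hq₂
  rw [hp₁, hp₂, hq₁, hq₂, classicalDiv_cross (hφ.differentiable x) (hψ.differentiable x)]

theorem inner_testGrad_testDiv {p : D.L2S × D.L2V} {q : D.L2V × D.L2S} (hp : p ∈ D.testGrad)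
    (hq : q ∈ D.testDiv) : inner ℝ p.2 q.1 + inner ℝ p.1 q.2 = 0 := by
  obtain ⟨f, hf, hp₁, hp₂⟩ := hp
  obtain ⟨φ, hφ, hq₁, hq₂⟩ := hq
  rw [L2.inner_def, L2.inner_def,
    ← integral_add (L2.integrable_inner _ _) (L2.integrable_inner _ _),
    ← (hf.bilin hφ (ContinuousLinearMap.lsmul ℝ ℝ)).integral_classicalDiv]
  refine integral_congr_ae ?_
  filter_upwards [hp₁, hp₂, hq₁, hq₂] with x hp₁ hp₂ hq₁ hq₂
  rw [hp₁, hp₂, hq₁, hq₂]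
  exact (classicalDiv_smul (hf.differentiable x) (hφ.differentiable x)).symm

theorem IsCurl₀.inner_curl_comm {v w v' w' : D.L2V} (h : D.IsCurl₀ v w) (h' : D.IsCurl₀ v' w') :
    inner ℝ v w' = inner ℝ w v' := by
  have hclosure := map_mem_closure₂ (u := {(0 : ℝ)})
    (f := fun p q : D.L2V × D.L2V => inner ℝ p.1 q.2 - inner ℝ p.2 q.1) (by fun_prop) h h'
    fun p hp q hq => sub_eq_zero.2 (testCurl_symm hp hq)
  rwa [closure_singleton, mem_singleton_iff, sub_eq_zero] at hclosure

theorem IsGrad₀.inner_add_inner {f : D.L2S} {g v : D.L2V} {q : D.L2S} (hf : D.IsGrad₀ f g)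
    (hv : D.IsDiv₀ v q) : inner ℝ g v + inner ℝ f q = 0 := by
  have hclosure := map_mem_closure₂ (u := {(0 : ℝ)})
    (f := fun (p : D.L2S × D.L2V) (q : D.L2V × D.L2S) => inner ℝ p.2 q.1 + inner ℝ p.1 q.2)
    (by fun_prop) hf hv fun p hp q hq => inner_testGrad_testDiv hp hq
  rwa [closure_singleton, mem_singleton_iff] at hclosure

theorem IsWeakCurl.inner_curl₀ {v w A cA : D.L2V} (hv : D.IsWeakCurl v w) (hA : D.IsCurl₀ A cA) :
    inner ℝ v cA = inner ℝ w A := by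
  have hclosed : IsClosed {p : D.L2V × D.L2V | (inner ℝ v p.2 : ℝ) = inner ℝ w p.1} :=
    isClosed_eq (by fun_prop) (by fun_prop)
  exact closure_minimal hv hclosed hA

theorem IsCurl₀.isDiv₀ {v w : D.L2V} (h : D.IsCurl₀ v w) : D.IsDiv₀ w 0 := by
  refine map_mem_closure (f := fun p : D.L2V × D.L2V => (p.2, (0 : D.L2S))) (by fun_prop) h ?_
  rintro p ⟨φ, hφ, -, hcurl⟩
  refine ⟨_, hφ.classicalCurl, hcurl, ?_⟩
  filter_upwards [Lp.coeFn_zero ℝ 2 D.vol] with x hx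
  have hφ₂ : ContDiffAt ℝ 2 φ x := (contDiff_infty.1 hφ.smooth 2).contDiffAt
  rw [hx, classicalDiv_classicalCurl hφ₂, Pi.zero_apply]

/-- Orthogonality of curl-free fields in `H₀(curl)` to divergence-free fields in `H₀(div)`. It
follows from exactness at `H₀(curl)`, and is weaker: a gradient that is normal to a disconnected
boundary need not come from `H¹₀`. -/
def CurlFreeOrthDivFree (D : Domain) : Prop :=
  ∀ A v : D.L2V, D.IsCurl₀ A 0 → D.IsDiv₀ v 0 → inner ℝ A v = 0

theorem ExactAtCurl.curlFreeOrthDivFree (hexact : D.ExactAtCurl) : D.CurlFreeOrthDivFree := by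
  intro A v hA hv
  obtain ⟨f, hf⟩ := hexact A hA
  simpa using hf.inner_add_inner hv

end Green

end Domain

namespace Domain

variable {D : Domain}

section Continuous

/-- The generalized helicity on `D` as that of a Hodge system. -/
def hodgeSystem (D : Domain) (hD : D.CurlFreeOrthDivFree) : HodgeSystem D.L2V where
  curl := D.curlGraph
  harmonic := {v | D.IsHarmonic v}
  curl_symm _ hp _ hq := IsCurl₀.inner_curl_comm hp hq
  harmonic_orth_range v hv p hp := by rw [hv.2.inner_curl₀ hp, inner_zero_left]
  harmonic_orth_ker v hv p hp hp₂ := hD p.1 v (hp₂ ▸ hp : D.IsCurl₀ p.1 0) hv.1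

variable {τ : ℝ} {I : Set ℝ} {B E j : ℝ → D.L2V} {u : ℝ → E3 → E3}

theorem IsSolution.inner_E_B (hsol : D.IsSolution τ I B E j u) {t : ℝ} (ht : t ∈ I) :
    inner ℝ (E t) (B t) = 0 := by
  rw [L2.inner_def]
  refine integral_eq_zero_of_ae ?_
  filter_upwards [hsol.ohm t ht] with x hx
  rw [eq_neg_of_add_eq_zero_left hx, inner_neg_left, inner_cross_self_right, neg_zero,
    Pi.zero_apply]

theorem IsSolution.isIdealFlow (hsol : D.IsSolution τ I B E j u) :
    IsIdealFlow D.curlGraph I B E where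
  continuousOn := hsol.continuous_E
  faraday := by
    obtain ⟨dB, hdB, hadv⟩ := hsol.advection
    refine ⟨fun t => -dB t, hdB.neg, fun t ht => ?_⟩
    obtain ⟨hderiv, cE, hcE, hsum⟩ := hadv t ht
    have hcE_eq : cE = -dB t := eq_neg_of_add_eq_zero_right hsum
    exact ⟨hcE_eq.subst (motive := D.IsCurl₀ (E t)) hcE, by rwa [neg_neg]⟩
  orthogonal _ := hsol.inner_E_B

end Continuous

namespace Subcomplex

variable (S : D.Subcomplex)

instance : FiniteDimensional ℝ S.V₁ := S.finite₁

instance : FiniteDimensional ℝ S.V₂ := S.finite₂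

/-- The graph of `curl : V₁ → V₂`. -/
def curlGraph : Submodule ℝ (D.L2V × D.L2V) := S.V₁.prod S.V₂ ⊓ D.curlGraph

variable {S} in
theorem mem_curlGraph {p : D.L2V × D.L2V} : p ∈ S.curlGraph ↔ S.IsCurl p.1 p.2 :=
  and_assoc

theorem isClosed_curlGraph : IsClosed (S.curlGraph : Set (D.L2V × D.L2V)) :=
  (S.V₁.closed_of_finiteDimensional.prod S.V₂.closed_of_finiteDimensional).inter
    Domain.isClosed_curlGraph

/-- The discrete generalized helicity as that of a Hodge system. -/
def hodgeSystem (hD : D.CurlFreeOrthDivFree) : HodgeSystem D.L2V where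
  curl := S.curlGraph
  harmonic := {v | S.IsHarmonic v}
  curl_symm _ hp _ hq := IsCurl₀.inner_curl_comm hp.2 hq.2
  harmonic_orth_range _ hv p hp := hv.2.2 p.1 p.2 (mem_curlGraph.1 hp)
  harmonic_orth_ker v hv p hp hp₂ := hD p.1 v (hp₂ ▸ hp.2 : D.IsCurl₀ p.1 0) hv.2.1

theorem hasHelicity_iff (hD : D.CurlFreeOrthDivFree) {B : D.L2V} {h : ℝ} :
    (S.hodgeSystem hD).HasHelicity B h ↔ S.HasHelicity B h := by
  simp only [HodgeSystem.HasHelicity, HodgeSystem.IsHodge, HasHelicity, IsHodge, hodgeSystem,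
    mem_curlGraph, mem_ofPred_eq]

theorem exists_hasHelicity {B : D.L2V} (hB : B ∈ S.V₂) (hdiv : D.IsDiv₀ B 0) :
    ∃ h, S.HasHelicity B h := by
  let W : Submodule ℝ D.L2V := S.curlGraph.map (LinearMap.snd ℝ D.L2V D.L2V)
  have hWV : W ≤ S.V₂ := by
    rintro _ ⟨p, hp, rfl⟩
    exact hp.1.2
  have : FiniteDimensional ℝ W := Submodule.finiteDimensional_of_le hWV
  obtain ⟨⟨A, cA⟩, hA, hcA⟩ : W.starProjection B ∈ W := W.starProjection_apply_mem B
  change cA = _ at hcA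
  refine ⟨_, A, B - cA, ⟨⟨S.V₂.sub_mem hB hA.1.2, ?_, fun K cK hK => ?_⟩, cA,
    mem_curlGraph.1 hA, (add_sub_cancel cA B).symm⟩, rfl⟩
  · simpa only [sub_zero] using hdiv.sub (IsCurl₀.isDiv₀ hA.2)
  · rw [hcA]
    exact W.starProjection_inner_eq_zero B cK ⟨(K, cK), mem_curlGraph.2 hK, rfl⟩

section Scheme

variable {S} {τ : ℝ}

/-- The scheme determines only the projection of `∂ₜB` to `V₂`. -/
theorem SchemeAt.isCurl {B dB E j H : D.L2V} (h : S.SchemeAt τ B dB E j H) :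
    S.IsCurl E (-S.V₂.starProjection dB) := by
  obtain ⟨cE, hcE, hadv⟩ := h.advection
  have hproj : S.V₂.starProjection dB = -cE :=
    Submodule.eq_starProjection_of_mem_of_inner_eq_zero (S.V₂.neg_mem hcE.2.1) fun C hC => by
      rw [sub_neg_eq_add, inner_add_left, hadv C hC]
  rwa [hproj, neg_neg]

/-- Test with `F = H`, where the triple product vanishes, and with `G = E`. -/
theorem SchemeAt.inner_E_B {B dB E j H : D.L2V} (h : S.SchemeAt τ B dB E j H) :
    inner ℝ E B = 0 := by
  have hohm := (h.ohm H h.mem_H).2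
  simp only [inner_cross_self_right, integral_zero, mul_zero, add_zero] at hohm
  rw [real_inner_comm, ← h.field E h.isCurl.1, real_inner_comm, hohm]

variable {I : Set ℝ} {B E j H : ℝ → D.L2V}

theorem IsSolution.mem_V₂ (hsol : S.IsSolution τ I B E j H) {t : ℝ} (ht : t ∈ I) :
    B t ∈ S.V₂ := by
  obtain ⟨dB, -, hscheme⟩ := hsol.scheme
  exact (hscheme t ht).2.mem_B

theorem IsSolution.isIdealFlow (hsol : S.IsSolution τ I B E j H) :
    IsIdealFlow S.curlGraph I B E := by
  obtain ⟨dB, hdB, hscheme⟩ := hsol.scheme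
  have hproj : EqOn (S.V₂.starProjection ∘ B) B I := fun t ht =>
    Submodule.starProjection_eq_self_iff.2 (hscheme t ht).2.mem_B
  refine ⟨hsol.continuous_E, ⟨fun t => -S.V₂.starProjection (dB t),
    (S.V₂.starProjection.continuous.comp_continuousOn hdB).neg, fun t ht =>
      ⟨mem_curlGraph.2 (hscheme t ht).2.isCurl, ?_⟩⟩, fun t ht => (hscheme t ht).2.inner_E_B⟩
  rw [neg_neg]
  exact (S.V₂.starProjection.hasFDerivAt.comp_hasDerivWithinAt t (hscheme t ht).1).congr
    hproj.symm (hproj ht).symm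

theorem IsCollocationStep.isIdealCollocationStep {s : ℕ} {c : Fin s → ℝ} {δ : ℝ} {B B' : D.L2V}
    (hstep : S.IsCollocationStep τ c δ B B') :
    IsIdealCollocationStep S.curlGraph c δ B B' := by
  obtain ⟨a, p, E, j, H, ha, hp, hp0, hpδ, hscheme⟩ := hstep
  obtain rfl : p = polyCurve a := funext hp
  have hproj : S.V₂.starProjection ∘ polyCurve a = polyCurve a (R := ℝ) := funext fun r =>
    Submodule.starProjection_eq_self_iff.2 (S.V₂.sum_mem fun k _ => S.V₂.smul_mem _ (ha k))
  refine ⟨a, E, fun i => -S.V₂.starProjection (deriv (polyCurve a) (c i * δ)), hp0, hpδ,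
    fun i => ⟨mem_curlGraph.2 (hscheme i).isCurl, ?_, (hscheme i).inner_E_B⟩⟩
  have hderiv := S.V₂.starProjection.hasFDerivAt.comp_hasDerivAt (c i * δ)
    (hasDerivAt_polyCurve a (c i * δ)).differentiableAt.hasDerivAt
  rwa [hproj, ← neg_neg (S.V₂.starProjection _)] at hderiv

end Scheme

end Subcomplex

end Domain

end MagnetoFriction

end

theorem theorem3p5_general (D : MagnetoFriction.Domain) (hD : D.CurlFreeOrthDivFree) :
    (∀ (I : Set ℝ) (B E : ℝ → D.L2V), I.OrdConnected →
      MagnetoFriction.IsIdealFlow D.curlGraph I B E → ∀ s ∈ I, ∀ h : ℝ, D.HasHelicity (B s) h →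
        ∀ t ∈ I, ∀ h' : ℝ, D.HasHelicity (B t) h' ↔ h' = h) ∧
    (∀ (S : D.Subcomplex) (I : Set ℝ) (B E : ℝ → D.L2V), I.OrdConnected →
      MagnetoFriction.IsIdealFlow S.curlGraph I B E → ∀ s ∈ I, B s ∈ S.V₂ → D.IsDiv₀ (B s) 0 →
        ∃ h : ℝ, ∀ t ∈ I, ∀ h' : ℝ, S.HasHelicity (B t) h' ↔ h' = h) ∧
    (∀ (S : D.Subcomplex) (s : ℕ) (c : Fin s → ℝ) (N : ℕ) (δ : ℕ → ℝ) (B : ℕ → D.L2V),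
      MagnetoFriction.IsGaussNodes c → B 0 ∈ S.V₂ → D.IsDiv₀ (B 0) 0 →
      (∀ n < N, MagnetoFriction.IsIdealCollocationStep S.curlGraph c (δ n) (B n) (B (n + 1))) →
        ∃ h : ℝ, ∀ n ≤ N, ∀ h' : ℝ, S.HasHelicity (B n) h' ↔ h' = h) := by
  refine ⟨fun I B E hI hflow s hs h H t ht h' => ?_, fun S I B E hI hflow s hs hB hdiv => ?_,
    fun S s c N δ B hc hB hdiv hstep => ?_⟩
  · let P := D.hodgeSystem hD
    exact (MagnetoFriction.HodgeSystem.HasHelicity.of_isIdealFlow (P := P)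
      MagnetoFriction.Domain.isClosed_curlGraph hI hflow hs ht H).iff_eq
  all_goals
    obtain ⟨h, H⟩ := S.exists_hasHelicity hB hdiv
    refine ⟨h, ?_⟩
    simp only [← S.hasHelicity_iff hD] at H ⊢
  · exact fun t ht h' => (H.of_isIdealFlow S.isClosed_curlGraph hI hflow hs ht).iff_eq
  · intro n hn h'
    refine MagnetoFriction.HodgeSystem.HasHelicity.iff_eq ?_
    induction n with
    | zero => exact H
    | succ n ih => exact (ih (by omega)).of_isIdealCollocationStep hc (hstep n (by omega))

theorem theorem3p5 (D : MagnetoFriction.Domain) (hexact : D.ExactAtCurl) (τ : ℝ) (hτ : 0 < τ) :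
    -- the magneto-frictional evolution
    (∀ (I : Set ℝ) (B E j : ℝ → D.L2V)
        (u : ℝ → MagnetoFriction.E3 → MagnetoFriction.E3),
        I.OrdConnected → I ⊆ Set.Ici 0 → 0 ∈ I → D.IsSolution τ I B E j u →
        ∀ s ∈ I, ∀ h : ℝ, D.HasHelicity (B s) h →
          ∀ t ∈ I, ∀ h' : ℝ, D.HasHelicity (B t) h' ↔ h' = h) ∧
    -- the semi-discrete scheme
    (∀ (S : D.Subcomplex) (I : Set ℝ) (B E j H : ℝ → D.L2V),
        I.OrdConnected → I ⊆ Set.Ici 0 → 0 ∈ I → S.IsSolution τ I B E j H →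
        ∃ h : ℝ, ∀ t ∈ I, ∀ h' : ℝ, S.HasHelicity (B t) h' ↔ h' = h) ∧
    -- the scheme with Gauss collocation in time
    (∀ (S : D.Subcomplex) (s : ℕ) (c : Fin s → ℝ) (N : ℕ) (δ : ℕ → ℝ) (B : ℕ → D.L2V),
        MagnetoFriction.IsGaussNodes c → (∀ n < N, 0 < δ n) → B 0 ∈ S.V₂ → D.IsDiv₀ (B 0) 0 →
        (∀ n < N, S.IsCollocationStep τ c (δ n) (B n) (B (n + 1))) →
        ∃ h : ℝ, ∀ n ≤ N, ∀ h' : ℝ, S.HasHelicity (B n) h' ↔ h' = h) :=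
  have main := theorem3p5_general D hexact.curlFreeOrthDivFree
  ⟨fun I B E _ _ hI _ _ hsol => main.1 I B E hI hsol.isIdealFlow,
    fun S I B E _ _ hI _ h0 hsol => main.2.1 S I B E hI hsol.isIdealFlow 0 h0 (hsol.mem_V₂ h0)
      hsol.gauss_zero,
    fun S s c N δ B hc _ hB hdiv hstep => main.2.2 S s c N δ B hc hB hdiv fun n hn =>
      (hstep n hn).isIdealCollocationStep⟩
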